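/- Let $\mathcal R$ be a property of bounded linear operators on complex Banach spaces of dimension at least $2$ such that (a) $\mathcal R$ is inherited by quotients: if an operator $T$ on a complex Banach space $Y$ has $\mathcal R$ and $\mathcal N \subseteq \mathcal M$ are closed subspaces of $Y$ invariant under $T$ with $\dim(\mathcal M/\mathcal N) \ge 2$, then the operator $x + \mathcal N \mapsto Tx + \mathcal N$ on $\mathcal M/\mathcal N$ has $\mathcal R$; (b) every commutative multiplicative semigroup of operators on a complex Banach space $Y$ with $\dim Y \ge 2$, all of whose members have $\mathcal R$, has a non-trivial invariant subspace, that is, a closed subspace different from $\{0\}$ and $Y$ that is mapped into itself by every member of the semigroup. Let $X$ be a complex Banach space of dimension at least $2$ and let $\mathcal S$ be a multiplicative semigroup of bounded linear operators on $X$, all of whose members have $\mathcal R$. If the rank of $ST - TS$ is at most $1$ for all $S, T \in \mathcal S$, then $\mathcal S$ is triangularizable: there is a chain of closed subspaces of $X$, each invariant under every member of $\mathcal S$, that is maximal among all chains of closed subspaces of $X$. -/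

import Mathlib

universe u

namespace OperatorSemigroup

/-- A property of (bounded linear) operators on complex Banach spaces. It may depend on the whole
Banach space structure; its values on spaces of dimension at most one play no role below. -/
abbrev OperatorProperty : Type (u + 1) :=
  ∀ (Y : Type u) [NormedAddCommGroup Y] [NormedSpace ℂ Y] [CompleteSpace Y], (Y →L[ℂ] Y) → Prop

section

variable {X : Type u} [NormedAddCommGroup X] [NormedSpace ℂ X]

/-- The closed subspace `M` is invariant under the operator `T`. -/
def IsInvariant (M : ClosedSubmodule ℂ X) (T : X →L[ℂ] X) : Prop :=
  ∀ x ∈ M, T x ∈ M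

/-- The closed subspace `M` is invariant under every operator of the collection `C`. -/
def IsInvariantUnder (M : ClosedSubmodule ℂ X) (C : Set (X →L[ℂ] X)) : Prop :=
  ∀ T ∈ C, IsInvariant M T

/-- The collection `C` has an invariant closed subspace other than `{0}` and the whole space. -/
def HasNontrivialInvariantSubspace (C : Set (X →L[ℂ] X)) : Prop :=
  ∃ M : ClosedSubmodule ℂ X, M ≠ ⊥ ∧ M ≠ ⊤ ∧ IsInvariantUnder M C

/-- There is a chain of closed subspaces, all invariant under `C`, that is maximal among all chains
of closed subspaces. -/
def Triangularizable (C : Set (X →L[ℂ] X)) : Prop :=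
  ∃ K : Set (ClosedSubmodule ℂ X),
    IsMaxChain (· ≤ ·) K ∧ ∀ M ∈ K, IsInvariantUnder M C

instance isClosed_submoduleOf (N M : ClosedSubmodule ℂ X) :
    IsClosed ((N.toSubmodule.submoduleOf M.toSubmodule : Submodule ℂ M.toSubmodule) :
      Set M.toSubmodule) :=
  N.isClosed.preimage continuous_subtype_val

instance completeSpace_closedSubmodule [CompleteSpace X] (M : ClosedSubmodule ℂ X) :
    CompleteSpace M.toSubmodule :=
  M.isClosed.completeSpace_coe

/-- The space `M / N`, for closed subspaces `N ≤ M` of `X`, with the quotient norm. -/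
abbrev SubQuotient (M N : ClosedSubmodule ℂ X) : Type u :=
  M.toSubmodule ⧸ N.toSubmodule.submoduleOf M.toSubmodule

/-- The operator `x + N ↦ T x + N` that `T` induces on `M / N`. -/
noncomputable def quotientOperator (M N : ClosedSubmodule ℂ X) (T : X →L[ℂ] X)
    (hM : IsInvariant M T) (hN : IsInvariant N T) :
    SubQuotient M N →L[ℂ] SubQuotient M N :=
  Submodule.liftQL (N.toSubmodule.submoduleOf M.toSubmodule)
    ((N.toSubmodule.submoduleOf M.toSubmodule).mkQL ∘L
      T.restrict (p := M.toSubmodule) (q := M.toSubmodule) hM)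
    (fun x hx => by
      have hx' : (x : X) ∈ N := hx
      have h : T x ∈ N := hN _ hx'
      exact (Submodule.Quotient.mk_eq_zero (N.toSubmodule.submoduleOf M.toSubmodule)
        (x := ⟨T x, hM x x.2⟩)).2 h)

theorem quotientOperator_mk (M N : ClosedSubmodule ℂ X) (T : X →L[ℂ] X)
    (hM : IsInvariant M T) (hN : IsInvariant N T) (x : M.toSubmodule) :
    quotientOperator M N T hM hN (Submodule.Quotient.mk x) =
      Submodule.Quotient.mk ⟨T x, hM x x.2⟩ := rfl

end

/-- If `T` has the property `R`, so does the operator that `T` induces on any quotient `M / N` of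
dimension at least two of closed subspaces `N ≤ M` invariant under `T`. Equivalently, whenever all
members of a collection have `R`, so do all members of every set of quotients of it. -/
def InheritedByQuotients (R : OperatorProperty.{u}) : Prop :=
  ∀ (Y : Type u) [NormedAddCommGroup Y] [NormedSpace ℂ Y] [CompleteSpace Y] (T : Y →L[ℂ] Y),
    R Y T → ∀ (M N : ClosedSubmodule ℂ Y) (_ : N ≤ M)
      (hM : IsInvariant M T) (hN : IsInvariant N T),
      2 ≤ Module.rank ℂ (SubQuotient M N) →
        R (SubQuotient M N) (quotientOperator M N T hM hN)

/-- Every commutative semigroup of operators with the property `R`, on a complex Banach space of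
dimension at least two, has a nontrivial invariant closed subspace. -/
def CommSemigroupsHaveInvariantSubspace (R : OperatorProperty.{u}) : Prop :=
  ∀ (Y : Type u) [NormedAddCommGroup Y] [NormedSpace ℂ Y] [CompleteSpace Y],
    2 ≤ Module.rank ℂ Y → ∀ S : Subsemigroup (Y →L[ℂ] Y),
      (∀ A ∈ S, R Y A) → (∀ A ∈ S, ∀ B ∈ S, A * B = B * A) →
        HasNontrivialInvariantSubspace (S : Set (Y →L[ℂ] Y))

end OperatorSemigroup

/-! The heart is the identity `tr([A, B] T) = 0` for all `A, B, T` in the semigroup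
(`HasRankOneCommutators.apply_apply_eq_zero`). If `[A, B] = φ ⊗ x ≠ 0`, it puts the orbit `S x`
inside the closed hyperplane `ker φ`, so the closed span of `S x`, or the line of `x` when `S x =
0`, is a nontrivial invariant subspace. Commutative semigroups are covered by (b).

The identity comes from Leibniz expansions such as `[A, BT] = [A, B] T + B [A, T]`: a sum of two
rank one maps has rank at most one only if their vectors or their functionals are proportional.
Applied to squares, this gives `[A, B]² = 0`; applied to three operators with nonzero trace, it
forces a cyclic pattern of proportionalities that contradicts itself (`Triple.false`).

Rank one commutators and the property pass to quotients `M / N`, so a maximal chain of invariant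
subspaces has no gap that another closed subspace could refine. -/

namespace OperatorSemigroup

/-! ### Linear algebra of rank one commutators. -/

section Algebra

variable {k V : Type*} [Field k] [AddCommGroup V] [Module k V]

theorem proportional_of_sum_rank_le_one {φ ψ θ : Module.Dual k V} {x y w : V}
    (h : ∀ v, φ v • y + ψ v • x = θ v • w) (hx : x ≠ 0) (hφ : φ ≠ 0) :
    (∃ c : k, y = c • x) ∨ ∃ c : k, ∀ v, ψ v = c * φ v := by
  obtain ⟨u, hu⟩ : ∃ u, φ u ≠ 0 := by
    by_contra! H
    exact hφ (LinearMap.ext H)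
  by_cases hker : ∀ v, φ v = 0 → ψ v = 0
  · refine Or.inr ⟨ψ u / φ u, fun v => ?_⟩
    have h1 := hker (v - (φ v / φ u) • u) (by simp [hu])
    simp only [map_sub, map_smul, smul_eq_mul] at h1
    field_simp at h1 ⊢
    linear_combination h1
  · push Not at hker
    obtain ⟨v, hv, hv'⟩ := hker
    have h1 := h v
    rw [hv, zero_smul, zero_add] at h1
    have hθ : θ v ≠ 0 := by
      intro h0
      rw [h0, zero_smul] at h1
      exact (smul_ne_zero hv' hx) h1
    have hw : w = ((θ v)⁻¹ * ψ v) • x := by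
      rw [mul_smul, h1, inv_smul_smul₀ hθ]
    have h2 := h u
    refine Or.inl ⟨(φ u)⁻¹ * (θ u * ((θ v)⁻¹ * ψ v) - ψ u), ?_⟩
    rw [mul_smul, sub_smul, mul_smul (θ u), ← hw, ← h2, add_sub_cancel_right, inv_smul_smul₀ hu]

theorem trace_eq_of_sum_rank_le_one {φ ψ θ : Module.Dual k V} {x y w : V}
    (h : ∀ v, φ v • x + ψ v • y = θ v • w) : φ x + ψ y = θ w := by
  -- All three maps have range in `W`, so their traces can be taken on this finite-dimensional
  -- space.
  let W : Submodule k V := Submodule.span k {x, y, w}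
  have hx : x ∈ W := Submodule.subset_span (by simp)
  have hy : y ∈ W := Submodule.subset_span (by simp)
  have hw : w ∈ W := Submodule.subset_span (by simp)
  have : FiniteDimensional k W := FiniteDimensional.span_of_finite k (by simp)
  have key : (φ ∘ₗ W.subtype).smulRight (⟨x, hx⟩ : W) + (ψ ∘ₗ W.subtype).smulRight (⟨y, hy⟩ : W)
      = (θ ∘ₗ W.subtype).smulRight (⟨w, hw⟩ : W) := by
    ext v
    simpa using h v
  have := congrArg (LinearMap.trace k W) key
  simpa [LinearMap.trace_smulRight] using this

/-- A multiplicatively closed set of linear maps, all of whose commutators have rank at most one. -/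
structure HasRankOneCommutators (S : Set (Module.End k V)) : Prop where
  mul_mem : ∀ A ∈ S, ∀ B ∈ S, A * B ∈ S
  commutator : ∀ A ∈ S, ∀ B ∈ S, ∃ (φ : Module.Dual k V) (x : V), ∀ v, A (B v) - B (A v) = φ v • x

namespace HasRankOneCommutators

variable {S : Set (Module.End k V)} {A B T : Module.End k V} {φ ψ χ : Module.Dual k V} {x y z : V}

/-- `[A, B²] = [A, B] B + B [A, B] = (φ ∘ B) ⊗ x + φ ⊗ B x` has rank at most one. -/
theorem eigen_or (hS : HasRankOneCommutators S) (hA : A ∈ S) (hB : B ∈ S)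
    (h : ∀ v, A (B v) - B (A v) = φ v • x) (hx : x ≠ 0) (hφ : φ ≠ 0) :
    (∃ b : k, B x = b • x) ∨ ∃ b : k, ∀ v, φ (B v) = b * φ v := by
  obtain ⟨θ, w, hθ⟩ := hS.commutator A hA (B * B) (hS.mul_mem B hB B hB)
  refine proportional_of_sum_rank_le_one (ψ := φ ∘ₗ B) (θ := θ) (w := w) (fun v => ?_) hx hφ
  rw [← hθ v, LinearMap.comp_apply, ← h, ← map_smul, ← h]
  simp

theorem eigen_or_left (hS : HasRankOneCommutators S) (hA : A ∈ S) (hB : B ∈ S)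
    (h : ∀ v, A (B v) - B (A v) = φ v • x) (hx : x ≠ 0) (hφ : φ ≠ 0) :
    (∃ a : k, A x = a • x) ∨ ∃ a : k, ∀ v, φ (A v) = a * φ v := by
  have := hS.eigen_or hB hA (φ := -φ) (x := x) (fun v => by simp [← h]) hx (neg_ne_zero.2 hφ)
  simpa using this

theorem apply_eq_zero_of_eigenvector {a b : k} (h : ∀ v, A (B v) - B (A v) = φ v • x)
    (hA : A x = a • x) (hB : B x = b • x) : φ x = 0 := by
  have h1 := h x
  rw [hA, hB, map_smul, map_smul, hA, hB, smul_comm, sub_self, eq_comm, smul_eq_zero] at h1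
  rcases h1 with h1 | rfl
  · exact h1
  · simp

theorem apply_eq_zero_of_eigenfunctional {a b : k} (h : ∀ v, A (B v) - B (A v) = φ v • x)
    (hA : ∀ v, φ (A v) = a * φ v) (hB : ∀ v, φ (B v) = b * φ v) : φ x = 0 := by
  have h1 := congrArg φ (h x)
  rw [map_sub, hA, hB, hB, hA, map_smul, smul_eq_mul] at h1
  have h2 : φ x * φ x = 0 := by linear_combination -h1
  exact mul_self_eq_zero.1 h2

theorem apply_eq_zero_of_mixed (hS : HasRankOneCommutators S) (hA : A ∈ S) (hB : B ∈ S)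
    (h : ∀ v, A (B v) - B (A v) = φ v • x) (hφ : φ ≠ 0) {a b : k}
    (hAx : A x = a • x) (hBφ : ∀ v, φ (B v) = b * φ v) : φ x = 0 := by
  by_contra hne
  -- With `u = B x + b x`, `[A, B²] = φ ⊗ u` and `[A², B²] = φ ⊗ A u + (φ ∘ A) ⊗ u`. Hence `u` is an
  -- eigenvector of `A` or `φ` is an eigenfunctional of `A`.
  have hu : B x + b • x ≠ 0 := by
    intro h0
    refine hne (apply_eq_zero_of_eigenvector h hAx (b := -b) ?_)
    rw [neg_smul]
    exact eq_neg_of_add_eq_zero_left h0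
  obtain ⟨θ, w, hθ⟩ := hS.commutator (A * A) (hS.mul_mem A hA A hA) (B * B) (hS.mul_mem B hB B hB)
  have hBB : ∀ v, A (B (B v)) - B (B (A v)) = φ v • (B x + b • x) := by
    intro v
    have h1 := h (B v)
    have h2 := congrArg B (h v)
    rw [hBφ] at h1
    rw [map_sub, map_smul] at h2
    rw [smul_add, ← h2, smul_smul, mul_comm, ← h1]
    abel
  have hsum : ∀ v, φ v • A (B x + b • x) + (φ ∘ₗ A) v • (B x + b • x) = θ v • w := by
    intro v
    rw [← hθ v, LinearMap.comp_apply, ← hBB, ← map_smul, ← hBB]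
    simp
  rcases proportional_of_sum_rank_le_one hsum hu hφ with ⟨c, hc⟩ | ⟨c, hc⟩
  · have h1 : A (B x) = a • B x + φ x • x := by
      rw [← h x, hAx, map_smul]
      abel
    -- Either `c = a` and `φ x = 0`, or `u` is a multiple of `x`, which makes `x` a common
    -- eigenvector.
    have h2 : φ x • x = (c - a) • (B x + b • x) := by
      rw [sub_smul, ← hc, map_add, map_smul, h1, hAx]
      module
    by_cases hca : c - a = 0
    · rw [hca, zero_smul, smul_eq_zero] at h2
      rcases h2 with h2 | rfl
      · exact hne h2
      · exact hne (map_zero φ)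
    · refine hne (apply_eq_zero_of_eigenvector h hAx (b := (c - a)⁻¹ * φ x - b) ?_)
      rw [sub_smul, mul_smul, h2, inv_smul_smul₀ hca, add_sub_cancel_right]
  · exact hne (apply_eq_zero_of_eigenfunctional h hc hBφ)

/-- A rank one commutator has square zero. -/
theorem apply_eq_zero (hS : HasRankOneCommutators S) (hA : A ∈ S) (hB : B ∈ S)
    (h : ∀ v, A (B v) - B (A v) = φ v • x) : φ x = 0 := by
  by_cases hx : x = 0
  · simp [hx]
  by_cases hφ : φ = 0
  · simp [hφ]
  rcases hS.eigen_or_left hA hB h hx hφ with ⟨a, ha⟩ | ⟨a, ha⟩ <;>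
    rcases hS.eigen_or hA hB h hx hφ with ⟨b, hb⟩ | ⟨b, hb⟩
  · exact apply_eq_zero_of_eigenvector h ha hb
  · exact hS.apply_eq_zero_of_mixed hA hB h hφ ha hb
  · have := hS.apply_eq_zero_of_mixed hB hA (φ := -φ) (x := x) (fun v => by simp [← h])
      (neg_ne_zero.2 hφ) hb (b := a) (by simpa using ha)
    simpa using this
  · exact apply_eq_zero_of_eigenfunctional h ha hb

/-- The products `[A, B] T` and `[T, A] B` have the same trace. -/
theorem apply_apply_eq (hS : HasRankOneCommutators S) (hA : A ∈ S) (hB : B ∈ S) (hT : T ∈ S)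
    (hx : ∀ v, A (B v) - B (A v) = φ v • x) (hy : ∀ v, T (A v) - A (T v) = ψ v • y) :
    φ (T x) = ψ (B y) := by
  -- `[A, BT] = [A, B] T - B [T, A]` is itself a rank one commutator, hence has trace zero.
  obtain ⟨θ, w, hθ⟩ := hS.commutator A hA (B * T) (hS.mul_mem B hB T hT)
  have hw := hS.apply_eq_zero hA (hS.mul_mem B hB T hT) hθ
  have := trace_eq_of_sum_rank_le_one (φ := φ ∘ₗ T) (x := x) (ψ := -ψ) (y := B y) (θ := θ) (w := w)
    (fun v => by
      rw [← hθ v, LinearMap.comp_apply, ← hx, LinearMap.neg_apply, neg_smul, ← map_smul, ← hy]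
      simp)
  rw [hw] at this
  simpa [← sub_eq_add_neg, sub_eq_zero] using this

end HasRankOneCommutators

/-- Three maps whose commutators are the rank one maps `φ ⊗ x`, `χ ⊗ z`, `ψ ⊗ y`, with products
`[A, B] T`, `[B, T] A`, `[T, A] B` of nonzero trace. -/
structure Triple (S : Set (Module.End k V)) (A B T : Module.End k V)
    (φ χ ψ : Module.Dual k V) (x z y : V) : Prop where
  hS : HasRankOneCommutators S
  hA : A ∈ S
  hB : B ∈ S
  hT : T ∈ S
  hx : ∀ v, A (B v) - B (A v) = φ v • x
  hz : ∀ v, B (T v) - T (B v) = χ v • z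
  hy : ∀ v, T (A v) - A (T v) = ψ v • y
  ne : φ (T x) ≠ 0

/-! ### Impossibility of a nonzero trace. -/

namespace Triple

variable {S : Set (Module.End k V)} {A B T : Module.End k V} {φ ψ χ : Module.Dual k V} {x y z : V}

theorem rotate (h : Triple S A B T φ χ ψ x z y) : Triple S B T A χ ψ φ z y x :=
  ⟨h.hS, h.hB, h.hT, h.hA, h.hz, h.hy, h.hx, by
    rw [h.hS.apply_apply_eq h.hB h.hT h.hA h.hz h.hx]; exact h.ne⟩

theorem flip (h : Triple S A B T φ χ ψ x z y) : Triple S B A T φ ψ χ (-x) (-y) (-z) :=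
  ⟨h.hS, h.hB, h.hA, h.hT, fun v => by simp [← h.hx], fun v => by simp [← h.hy],
    fun v => by simp [← h.hz], by simpa using h.ne⟩

theorem x_ne (h : Triple S A B T φ χ ψ x z y) : x ≠ 0 := by
  rintro rfl
  simpa using h.ne

theorem phi_ne (h : Triple S A B T φ χ ψ x z y) : φ ≠ 0 := by
  rintro rfl
  simpa using h.ne

theorem phi_x (h : Triple S A B T φ χ ψ x z y) : φ x = 0 := h.hS.apply_eq_zero h.hA h.hB h.hx

/-- The rank condition on `[A, BT] = (φ ∘ T) ⊗ x - ψ ⊗ B y`. -/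
theorem proportional (h : Triple S A B T φ χ ψ x z y) :
    (∃ c : k, B y = c • x) ∨ ∃ c : k, ∀ v, φ (T v) = c * ψ v := by
  obtain ⟨θ, w, hθ⟩ := h.hS.commutator A h.hA (B * T) (h.hS.mul_mem B h.hB T h.hT)
  have := proportional_of_sum_rank_le_one (φ := ψ) (y := -B y) (ψ := φ ∘ₗ T) (x := x)
    (θ := θ) (w := w) (fun v => by
      rw [← hθ v, LinearMap.comp_apply, ← h.hx, smul_neg, ← map_smul, ← h.hy]
      simp) h.x_ne h.rotate.rotate.phi_ne
  refine this.imp_left ?_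
  rintro ⟨c, hc⟩
  exact ⟨-c, by rw [neg_smul, ← hc, neg_neg]⟩

theorem proportional' (h : Triple S A B T φ χ ψ x z y) :
    (∃ c : k, A z = c • x) ∨ ∃ c : k, ∀ v, φ (T v) = c * χ v := by
  refine h.flip.proportional.imp_left ?_
  rintro ⟨c, hc⟩
  exact ⟨c, by simpa using hc⟩

theorem not_z_eq (h : Triple S A B T φ χ ψ x z y) (c : k) : z ≠ c • x := by
  intro hc
  have hc0 : c ≠ 0 := by
    rintro rfl
    exact h.rotate.x_ne (by simpa using hc)
  have hχ := h.rotate.phi_x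
  have hχx : χ x = 0 := by
    rw [hc, map_smul, smul_eq_mul] at hχ
    exact (mul_eq_zero.1 hχ).resolve_left hc0
  rcases h.proportional' with ⟨d, hd⟩ | ⟨d, hd⟩
  · exact h.rotate.ne (by rw [hd, map_smul, hχx, smul_zero])
  · exact h.ne (by rw [hd, hχx, mul_zero])

theorem not_chi_eq (h : Triple S A B T φ χ ψ x z y) (c : k) : ¬ ∀ v, χ v = c * φ v := by
  intro hc
  have hχx : χ x = 0 := by rw [hc, h.phi_x, mul_zero]
  rcases h.proportional' with ⟨d, hd⟩ | ⟨d, hd⟩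
  · exact h.rotate.ne (by rw [hd, map_smul, hχx, smul_zero])
  · exact h.ne (by rw [hd, hχx, mul_zero])

/-- The cyclic configuration in which `B`, `T`, `A` map the lines of `y`, `x`, `z` to those of
`x`, `z`, `y` is impossible. -/
theorem not_cyclic (h : Triple S A B T φ χ ψ x z y) {a b t a' b' t' : k}
    (hB : B y = b • x) (hT : T x = t • z) (hA : A z = a • y)
    (hA' : ∀ v, χ (A v) = a' * ψ v) (hB' : ∀ v, ψ (B v) = b' * φ v)
    (hT' : ∀ v, φ (T v) = t' * χ v) : False := by
  have nφ := h.ne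
  have nχ := h.rotate.ne
  have nψ := h.rotate.rotate.ne
  have pφ := h.phi_x
  have pχ := h.rotate.phi_x
  have pψ := h.rotate.rotate.phi_x
  have hb : b ≠ 0 := by rintro rfl; simp [hB] at nψ
  have ha : a ≠ 0 := by rintro rfl; simp [hA] at nχ
  have ht : t ≠ 0 := by rintro rfl; simp [hT] at nφ
  have ha' : a' ≠ 0 := by rintro rfl; simp [hA'] at nχ
  have hb' : b' ≠ 0 := by rintro rfl; simp [hB'] at nψ
  have ht' : t' ≠ 0 := by rintro rfl; simp [hT'] at nφ
  have hψx : ψ x ≠ 0 := by intro h0; simp [hB, h0] at nψ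
  have hφy : φ y ≠ 0 := by intro h0; simp [hB', h0] at nψ
  -- Either `y` is an eigenvector of `A` or `ψ` an eigenfunctional. In the first case `[A, B]` at
  -- `y` makes `x` an eigenvector of `A`, and `[T, A]` at `x` then makes `z` and `y` proportional.
  -- The second case is dual and makes `χ` and `ψ` proportional.
  rcases h.hS.eigen_or h.hT h.hA h.hy h.rotate.rotate.x_ne h.rotate.rotate.phi_ne with
    ⟨e, he⟩ | ⟨e, he⟩
  · have h1 : A x = (e + b⁻¹ * φ y) • x := by
      have h2 := h.hx y
      rw [hB, he, map_smul, map_smul, hB] at h2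
      have h3 : b • A x = b • ((e + b⁻¹ * φ y) • x) := by
        rw [sub_eq_iff_eq_add.1 h2, smul_smul, smul_smul, mul_add, mul_inv_cancel_left₀ hb,
          add_smul, add_comm, mul_comm e b]
      exact smul_right_injective V hb h3
    have h4 : e + b⁻¹ * φ y ≠ 0 := by
      intro h0
      have h5 := hA' x
      rw [h1, h0, zero_smul, map_zero, eq_comm, mul_eq_zero] at h5
      exact h5.elim ha' hψx
    have h6 := h.hy x
    rw [h1, hT, map_smul, map_smul, hT, hA, smul_smul, smul_smul, sub_eq_iff_eq_add,
      ← add_smul] at h6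
    refine h.rotate.not_z_eq (((e + b⁻¹ * φ y) * t) / (ψ x + t * a)) ?_
    have h7 : ψ x + t * a ≠ 0 := by
      intro h0
      rw [h0, zero_smul, smul_eq_zero] at h6
      exact h6.elim (mul_ne_zero h4 ht) h.rotate.x_ne
    rw [div_eq_inv_mul, mul_smul, h6, inv_smul_smul₀ h7]
  · have h1 : ∀ v, φ (A v) = (e - b'⁻¹ * ψ x) * φ v := by
      intro v
      have h2 := congrArg ψ (h.hx v)
      rw [map_sub, he, hB', hB', map_smul, smul_eq_mul] at h2
      field_simp
      linear_combination -h2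
    have h4 : e - b'⁻¹ * ψ x ≠ 0 := by
      intro h0
      have h5 := h1 z
      rw [hA, h0, zero_mul, map_smul, smul_eq_mul, mul_eq_zero] at h5
      exact h5.elim ha hφy
    have h6 : ∀ v, (e - b'⁻¹ * ψ x) * t' * χ v = (t' * a' - φ y) * ψ v := by
      intro v
      have h7 := congrArg φ (h.hy v)
      rw [map_sub, hT', h1, hT', hA', map_smul, smul_eq_mul] at h7
      linear_combination -h7
    have h7 : t' * a' - φ y ≠ 0 := by
      intro h0
      refine h.rotate.phi_ne (LinearMap.ext fun v => ?_)
      have h8 := h6 v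
      rw [h0, zero_mul, mul_eq_zero] at h8
      exact h8.resolve_left (mul_ne_zero h4 ht')
    refine h.rotate.not_chi_eq (((e - b'⁻¹ * ψ x) * t') / (t' * a' - φ y)) fun v => ?_
    rw [div_mul_eq_mul_div, h6, mul_div_cancel_left₀ _ h7]

theorem not_parallel_of (h : Triple S A B T φ χ ψ x z y) (hB : ∃ b : k, B y = b • x) :
    ¬ ∃ b : k, B y = b • z := by
  rintro ⟨b₁, h1⟩
  obtain ⟨b, hb⟩ := hB
  have hb1 : b₁ ≠ 0 := by
    rintro rfl
    have := h.rotate.rotate.ne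
    simp [h1] at this
  refine h.not_z_eq (b₁⁻¹ * b) ?_
  rw [mul_smul, ← hb, h1, inv_smul_smul₀ hb1]

theorem not_proportional_of (h : Triple S A B T φ χ ψ x z y)
    (hT : ∃ t : k, ∀ v, φ (T v) = t * ψ v) : ¬ ∃ t : k, ∀ v, φ (T v) = t * χ v := by
  rintro ⟨t₁, h1⟩
  obtain ⟨t, ht⟩ := hT
  have ht0 : t ≠ 0 := by
    rintro rfl
    have := h.ne
    simp [ht] at this
  refine h.rotate.not_chi_eq (t⁻¹ * t₁) fun v => ?_
  rw [mul_assoc, ← h1, ht, inv_mul_cancel_left₀ ht0]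

/-- One vector alternative excludes its rival, which forces a functional alternative in the rotated
triple; that in turn forces the next vector alternative. Going round the cycle yields the pattern of
`not_cyclic`. -/
theorem not_image_y (h : Triple S A B T φ χ ψ x z y) (hB : ∃ b : k, B y = b • x) : False := by
  obtain ⟨b, hb⟩ := hB
  obtain ⟨a', hA'⟩ := h.rotate.proportional'.resolve_left (h.not_parallel_of ⟨b, hb⟩)
  obtain ⟨t, ht⟩ : ∃ c : k, T x = c • z :=
    h.rotate.proportional.resolve_right fun h2 => h.rotate.not_proportional_of h2 ⟨a', hA'⟩
  obtain ⟨b', hB'⟩ :=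
    h.rotate.rotate.proportional'.resolve_left (h.rotate.not_parallel_of ⟨t, ht⟩)
  obtain ⟨a, ha⟩ : ∃ c : k, A z = c • y :=
    h.rotate.rotate.proportional.resolve_right fun h2 =>
      h.rotate.rotate.not_proportional_of h2 ⟨b', hB'⟩
  obtain ⟨t', hT'⟩ := h.proportional'.resolve_left (h.rotate.rotate.not_parallel_of ⟨a, ha⟩)
  exact h.not_cyclic hb ht ha hA' hB' hT'

theorem false (h : Triple S A B T φ χ ψ x z y) : False := by
  rcases h.proportional with hB | hT
  · exact h.not_image_y hB
  · obtain ⟨c, hc⟩ := h.proportional'.resolve_right (h.not_proportional_of hT)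
    exact h.flip.not_image_y ⟨c, by simp [hc]⟩

end Triple

/-- The product of a rank one commutator with a third member of the semigroup has trace zero. -/
theorem HasRankOneCommutators.apply_apply_eq_zero {S : Set (Module.End k V)}
    (hS : HasRankOneCommutators S) {A B T : Module.End k V} (hA : A ∈ S) (hB : B ∈ S) (hT : T ∈ S)
    {φ : Module.Dual k V} {x : V} (hx : ∀ v, A (B v) - B (A v) = φ v • x) : φ (T x) = 0 := by
  obtain ⟨χ, z, hz⟩ := hS.commutator B hB T hT
  obtain ⟨ψ, y, hy⟩ := hS.commutator T hT A hA
  by_contra hne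
  exact Triple.false ⟨hS, hA, hB, hT, hx, hz, hy, hne⟩

end Algebra

/-! ### Nontrivial invariant subspaces. -/

section Reducibility

variable {X : Type u} [NormedAddCommGroup X] [NormedSpace ℂ X]

/-- All commutators of members of `S` have range in some line. -/
def CommutatorsInLines (S : Set (X →L[ℂ] X)) : Prop :=
  ∀ A ∈ S, ∀ B ∈ S, ∃ x : X, ∀ v, ∃ c : ℂ, A (B v) - B (A v) = c • x

theorem exists_functional_of_range_in_line {D : X →L[ℂ] X} {x : X}
    (h : ∀ v, ∃ c : ℂ, D v = c • x) : ∃ φ : X →L[ℂ] ℂ, ∀ v, D v = φ v • x := by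
  by_cases hx : x = 0
  · refine ⟨0, fun v => ?_⟩
    obtain ⟨c, hc⟩ := h v
    simp [hc, hx]
  · obtain ⟨g, hg⟩ := SeparatingDual.exists_eq_one (R := ℂ) hx
    refine ⟨g ∘L D, fun v => ?_⟩
    obtain ⟨c, hc⟩ := h v
    simp [hc, hg]

theorem exists_functional_of_commutator {S : Set (X →L[ℂ] X)} (hS : CommutatorsInLines S)
    {A B : X →L[ℂ] X} (hA : A ∈ S) (hB : B ∈ S) :
    ∃ (φ : X →L[ℂ] ℂ) (x : X), ∀ v, A (B v) - B (A v) = φ v • x := by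
  obtain ⟨x, hx⟩ := hS A hA B hB
  obtain ⟨φ, hφ⟩ := exists_functional_of_range_in_line (D := A * B - B * A) (x := x) hx
  exact ⟨φ, x, hφ⟩

theorem hasRankOneCommutators_image (S : Subsemigroup (X →L[ℂ] X))
    (hS : CommutatorsInLines (S : Set (X →L[ℂ] X))) :
    HasRankOneCommutators
      ((fun T : X →L[ℂ] X => (T : X →ₗ[ℂ] X)) '' S : Set (Module.End ℂ X)) where
  mul_mem := by
    rintro _ ⟨A, hA, rfl⟩ _ ⟨B, hB, rfl⟩
    exact ⟨A * B, S.mul_mem hA hB, rfl⟩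
  commutator := by
    rintro _ ⟨A, hA, rfl⟩ _ ⟨B, hB, rfl⟩
    obtain ⟨φ, x, h⟩ := exists_functional_of_commutator hS hA hB
    exact ⟨φ, x, h⟩

theorem isInvariant_closure_span {s : Set X} {T : X →L[ℂ] X}
    (h : ∀ x ∈ s, T x ∈ Submodule.span ℂ s) : IsInvariant (Submodule.span ℂ s).closure T := by
  have : (Submodule.span ℂ s).closure ≤ (Submodule.span ℂ s).closure.comap T := by
    rw [Submodule.closure_le]
    refine Submodule.span_le.2 fun x hx => ?_
    exact (Submodule.closure_le.1 le_rfl) (h x hx)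
  exact fun x hx => this hx

theorem hasNontrivialInvariantSubspace_of_span {C : Set (X →L[ℂ] X)} {s : Set X}
    (h : ∀ T ∈ C, ∀ x ∈ s, T x ∈ Submodule.span ℂ s) {x : X} (hx : x ∈ s) (hx0 : x ≠ 0)
    {φ : X →L[ℂ] ℂ} (hφ : φ ≠ 0) (hs : ∀ x ∈ s, φ x = 0) :
    HasNontrivialInvariantSubspace C := by
  refine ⟨(Submodule.span ℂ s).closure, ?_, ?_, fun T hT => isInvariant_closure_span (h T hT)⟩
  · intro h0
    have hmem : x ∈ (Submodule.span ℂ s).closure :=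
      (Submodule.closure_le.1 le_rfl) (Submodule.subset_span hx)
    rw [h0] at hmem
    exact hx0 hmem
  · intro h1
    have hle : (Submodule.span ℂ s).closure ≤ (⊥ : ClosedSubmodule ℂ ℂ).comap φ := by
      rw [Submodule.closure_le]
      exact Submodule.span_le.2 hs
    rw [h1] at hle
    exact hφ (ContinuousLinearMap.ext fun v => hle (ClosedSubmodule.mem_top (x := v)))

theorem exists_functional_vanishing (hX : 2 ≤ Module.rank ℂ X) (x : X) :
    ∃ φ : X →L[ℂ] ℂ, φ ≠ 0 ∧ φ x = 0 := by
  by_cases hx : x = 0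
  · have : Nontrivial X := by
      rw [← rank_pos_iff_nontrivial (R := ℂ)]
      exact lt_of_lt_of_le (by norm_num) hX
    obtain ⟨v, hv⟩ := exists_ne (0 : X)
    obtain ⟨g, hg⟩ := SeparatingDual.exists_eq_one (R := ℂ) hv
    exact ⟨g, by rintro rfl; simp at hg, by simp [hx]⟩
  · obtain ⟨g, hg⟩ := SeparatingDual.exists_eq_one (R := ℂ) hx
    obtain ⟨v, hv⟩ : ∃ v, v - g v • x ≠ 0 := by
      by_contra! H
      have : Module.rank ℂ X ≤ 1 :=
        rank_le_one_iff.2 ⟨x, fun v => ⟨g v, (sub_eq_zero.1 (H v)).symm⟩⟩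
      exact absurd (hX.trans this) (by norm_num)
    obtain ⟨f, hf⟩ := SeparatingDual.exists_eq_one (R := ℂ) hv
    refine ⟨f - f x • g, fun h0 => ?_, by simp [hg]⟩
    have := DFunLike.congr_fun h0 v
    simp only [map_sub, map_smul, smul_eq_mul] at hf
    simp only [sub_apply, smul_apply, smul_eq_mul, zero_apply] at this
    rw [mul_comm, this] at hf
    exact zero_ne_one hf

theorem hasNontrivialInvariantSubspace_of_not_commute (hX : 2 ≤ Module.rank ℂ X)
    (S : Subsemigroup (X →L[ℂ] X)) (hS : CommutatorsInLines (S : Set (X →L[ℂ] X)))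
    {A B : X →L[ℂ] X} (hA : A ∈ S) (hB : B ∈ S) (hAB : A * B ≠ B * A) :
    HasNontrivialInvariantSubspace (S : Set (X →L[ℂ] X)) := by
  obtain ⟨φ, x, hx⟩ := exists_functional_of_commutator hS hA hB
  have hφ : φ ≠ 0 := by
    rintro rfl
    exact hAB (ContinuousLinearMap.ext fun v => sub_eq_zero.1 (by simpa using hx v))
  have hx0 : x ≠ 0 := by
    rintro rfl
    exact hAB (ContinuousLinearMap.ext fun v => sub_eq_zero.1 (by simpa using hx v))
  -- The semigroup need not contain the identity, so the orbit of `x` may vanish; then the line of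
  -- `x` serves instead.
  by_cases h0 : ∀ T ∈ S, T x = 0
  · obtain ⟨g, hg, hgx⟩ := exists_functional_vanishing hX x
    refine hasNontrivialInvariantSubspace_of_span (s := {x}) ?_ rfl hx0 hg (by simpa using hgx)
    rintro T hT _ rfl
    rw [h0 T hT]
    exact zero_mem _
  · push Not at h0
    obtain ⟨T, hT, hTx⟩ := h0
    refine hasNontrivialInvariantSubspace_of_span (s := {v | ∃ T ∈ S, v = T x}) ?_
      ⟨T, hT, rfl⟩ hTx hφ ?_
    · rintro U hU _ ⟨T, hT, rfl⟩
      exact Submodule.subset_span ⟨U * T, S.mul_mem hU hT, rfl⟩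
    · rintro _ ⟨T, hT, rfl⟩
      exact (hasRankOneCommutators_image S hS).apply_apply_eq_zero (φ := (φ : X →ₗ[ℂ] ℂ))
        ⟨A, hA, rfl⟩ ⟨B, hB, rfl⟩ ⟨T, hT, rfl⟩ hx

theorem hasNontrivialInvariantSubspace [CompleteSpace X] {R : OperatorProperty.{u}}
    (hcomm : CommSemigroupsHaveInvariantSubspace R) (hX : 2 ≤ Module.rank ℂ X)
    (S : Subsemigroup (X →L[ℂ] X)) (hR : ∀ A ∈ S, R X A)
    (hS : CommutatorsInLines (S : Set (X →L[ℂ] X))) :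
    HasNontrivialInvariantSubspace (S : Set (X →L[ℂ] X)) := by
  by_cases h : ∀ A ∈ S, ∀ B ∈ S, A * B = B * A
  · exact hcomm X hX S hR h
  · push Not at h
    obtain ⟨A, hA, B, hB, hAB⟩ := h
    exact hasNontrivialInvariantSubspace_of_not_commute hX S hS hA hB hAB

end Reducibility

/-! ### Passage to quotients. -/

section Quotients

variable {X : Type u} [NormedAddCommGroup X] [NormedSpace ℂ X]

/-- The semigroup of operators that the members of `S` induce on `M / N`. -/
def quotientSemigroup (S : Subsemigroup (X →L[ℂ] X)) (M N : ClosedSubmodule ℂ X)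
    (hM : IsInvariantUnder M (S : Set (X →L[ℂ] X)))
    (hN : IsInvariantUnder N (S : Set (X →L[ℂ] X))) :
    Subsemigroup (SubQuotient M N →L[ℂ] SubQuotient M N) where
  carrier := {Q | ∃ (T : X →L[ℂ] X) (hT : T ∈ S), Q = quotientOperator M N T (hM T hT) (hN T hT)}
  mul_mem' := by
    rintro _ _ ⟨A, hA, rfl⟩ ⟨B, hB, rfl⟩
    refine ⟨A * B, S.mul_mem hA hB, ?_⟩
    ext q
    obtain ⟨q, rfl⟩ := Submodule.Quotient.mk_surjective _ q
    rfl

theorem commutatorsInLines_quotientSemigroup {S : Subsemigroup (X →L[ℂ] X)}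
    (hS : CommutatorsInLines (S : Set (X →L[ℂ] X))) {M N : ClosedSubmodule ℂ X}
    (hM : IsInvariantUnder M (S : Set (X →L[ℂ] X)))
    (hN : IsInvariantUnder N (S : Set (X →L[ℂ] X))) :
    CommutatorsInLines
      (quotientSemigroup S M N hM hN : Set (SubQuotient M N →L[ℂ] SubQuotient M N)) := by
  rintro _ ⟨A, hA, rfl⟩ _ ⟨B, hB, rfl⟩
  obtain ⟨x, hx⟩ := hS A hA B hB
  have hmem : ∀ v ∈ M, A (B v) - B (A v) ∈ M := fun v hv =>
    M.toSubmodule.sub_mem (hM A hA _ (hM B hB v hv)) (hM B hB _ (hM A hA v hv))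
  suffices H : ∃ y : M.toSubmodule, ∀ v : M.toSubmodule, ∃ c : ℂ,
      A (B v) - B (A v) = c • (y : X) by
    obtain ⟨y, hy⟩ := H
    refine ⟨Submodule.Quotient.mk y, fun q => ?_⟩
    obtain ⟨v, rfl⟩ := Submodule.Quotient.mk_surjective _ q
    obtain ⟨c, hc⟩ := hy v
    refine ⟨c, ?_⟩
    simp only [quotientOperator_mk]
    rw [← Submodule.Quotient.mk_sub, ← Submodule.Quotient.mk_smul]
    exact congrArg _ (Subtype.ext hc)
  -- The line of `x` need not lie in `M`; but if the commutator is nonzero somewhere on `M`, its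
  -- value there is a nonzero multiple of `x`, so `x ∈ M`.
  by_cases h0 : ∀ v ∈ M, A (B v) - B (A v) = 0
  · exact ⟨0, fun v => ⟨0, by simp [h0 v v.2]⟩⟩
  · push Not at h0
    obtain ⟨v, hv, hv0⟩ := h0
    obtain ⟨c, hc⟩ := hx v
    have hc0 : c ≠ 0 := by
      rintro rfl
      exact hv0 (by simpa using hc)
    refine ⟨⟨x, ?_⟩, fun v => hx v⟩
    have := M.toSubmodule.smul_mem c⁻¹ (hmem v hv)
    rwa [hc, inv_smul_smul₀ hc0] at this

theorem two_le_rank_subQuotient {M L N : ClosedSubmodule ℂ X} (hNL : N < L) (hLM : L < M) :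
    2 ≤ Module.rank ℂ (SubQuotient M N) := by
  by_contra! hlt
  have h1 : Module.rank ℂ (SubQuotient M N) ≤ 1 := by
    obtain ⟨n, hn⟩ := Cardinal.lt_aleph0.1 (hlt.trans (Cardinal.natCast_lt_aleph0 (n := 2)))
    rw [hn] at hlt ⊢
    norm_cast at hlt ⊢
    omega
  obtain ⟨w, hw⟩ := rank_le_one_iff.1 h1
  obtain ⟨w, rfl⟩ := Submodule.Quotient.mk_surjective _ w
  obtain ⟨l, hl, hlN⟩ := SetLike.exists_of_lt hNL
  obtain ⟨m, hm, hmL⟩ := SetLike.exists_of_lt hLM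
  have key : ∀ v (hv : v ∈ M), ∃ c : ℂ, c • (w : X) - v ∈ N := by
    intro v hv
    obtain ⟨c, hc⟩ := hw (Submodule.Quotient.mk ⟨v, hv⟩)
    rw [← Submodule.Quotient.mk_smul, Submodule.Quotient.eq] at hc
    exact ⟨c, hc⟩
  obtain ⟨c, hc⟩ := key l (hLM.le hl)
  obtain ⟨d, hd⟩ := key m hm
  have hc0 : c ≠ 0 := by
    rintro rfl
    exact hlN (by simpa using N.toSubmodule.neg_mem hc)
  have hwL : (w : X) ∈ L := by
    have := L.toSubmodule.smul_mem c⁻¹ (L.toSubmodule.add_mem (hNL.le hc) hl)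
    rwa [sub_add_cancel, inv_smul_smul₀ hc0] at this
  refine hmL ?_
  have := L.toSubmodule.sub_mem (L.toSubmodule.smul_mem d hwL) (hNL.le hd)
  rwa [sub_sub_cancel] at this

/-- The preimage in `X` of a closed subspace of `M / N`. -/
def liftSubQuotient (M N : ClosedSubmodule ℂ X) (Q : ClosedSubmodule ℂ (SubQuotient M N)) :
    ClosedSubmodule ℂ X where
  toSubmodule := (Q.toSubmodule.comap (N.toSubmodule.submoduleOf M.toSubmodule).mkQ).map
    M.toSubmodule.subtype
  isClosed' := by
    have h1 : IsClosed (((N.toSubmodule.submoduleOf M.toSubmodule).mkQL) ⁻¹'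
        (Q : Set (SubQuotient M N))) := Q.isClosed.preimage (ContinuousLinearMap.continuous _)
    exact (M.isClosed.isClosedEmbedding_subtypeVal).isClosedMap _ h1

theorem mem_liftSubQuotient {M N : ClosedSubmodule ℂ X} {Q : ClosedSubmodule ℂ (SubQuotient M N)}
    {x : X} : x ∈ liftSubQuotient M N Q ↔
      ∃ hx : x ∈ M, (Submodule.Quotient.mk ⟨x, hx⟩ : SubQuotient M N) ∈ Q := by
  constructor
  · rintro ⟨y, hy, rfl⟩
    exact ⟨y.2, hy⟩
  · rintro ⟨hx, h⟩
    exact ⟨⟨x, hx⟩, h, rfl⟩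

theorem exists_invariant_between {S : Subsemigroup (X →L[ℂ] X)} {M N : ClosedSubmodule ℂ X}
    (hNM : N ≤ M) (hM : IsInvariantUnder M (S : Set (X →L[ℂ] X)))
    (hN : IsInvariantUnder N (S : Set (X →L[ℂ] X)))
    (h : HasNontrivialInvariantSubspace
      (quotientSemigroup S M N hM hN : Set (SubQuotient M N →L[ℂ] SubQuotient M N))) :
    ∃ L, N < L ∧ L < M ∧ IsInvariantUnder L (S : Set (X →L[ℂ] X)) := by
  obtain ⟨Q, hbot, htop, hQ⟩ := h
  refine ⟨liftSubQuotient M N Q, lt_of_le_of_ne (fun x hx => ?_) fun heq => ?_,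
    lt_of_le_of_ne (fun x hx => ?_) fun heq => ?_, fun T hT x hx => ?_⟩
  · refine mem_liftSubQuotient.2 ⟨hNM hx, ?_⟩
    rw [(Submodule.Quotient.mk_eq_zero _).2 (show (⟨x, hNM hx⟩ : M.toSubmodule) ∈
      N.toSubmodule.submoduleOf M.toSubmodule from hx)]
    exact Q.toSubmodule.zero_mem
  · refine hbot (eq_bot_iff.2 fun q hq => ?_)
    obtain ⟨q, rfl⟩ := Submodule.Quotient.mk_surjective _ q
    have : (q : X) ∈ N := by
      rw [heq]
      exact mem_liftSubQuotient.2 ⟨q.2, hq⟩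
    exact (Submodule.Quotient.mk_eq_zero _).2 this
  · exact (mem_liftSubQuotient.1 hx).1
  · refine htop (eq_top_iff.2 fun q _ => ?_)
    obtain ⟨q, rfl⟩ := Submodule.Quotient.mk_surjective _ q
    have : (q : X) ∈ liftSubQuotient M N Q := by
      rw [heq]
      exact q.2
    exact (mem_liftSubQuotient.1 this).2
  · obtain ⟨hxM, hxQ⟩ := mem_liftSubQuotient.1 hx
    exact mem_liftSubQuotient.2 ⟨hM T hT x hxM, hQ _ ⟨T, hT, rfl⟩ _ hxQ⟩

end Quotients

/-! ### From invariant subspaces in gaps to maximal chains. -/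

section Chains

variable {X : Type u} [NormedAddCommGroup X] [NormedSpace ℂ X]

theorem isInvariantUnder_sSup {C : Set (X →L[ℂ] X)} {K : Set (ClosedSubmodule ℂ X)}
    (hK : ∀ M ∈ K, IsInvariantUnder M C) : IsInvariantUnder (sSup K) C := by
  intro T hT
  have : sSup K ≤ (sSup K).comap T := sSup_le fun M hM x hx =>
    (le_sSup hM : M ≤ sSup K) (hK M hM T hT x hx)
  exact fun x hx => this hx

theorem isInvariantUnder_sInf {C : Set (X →L[ℂ] X)} {K : Set (ClosedSubmodule ℂ X)}
    (hK : ∀ M ∈ K, IsInvariantUnder M C) : IsInvariantUnder (sInf K) C := by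
  intro T hT x hx
  rw [ClosedSubmodule.mem_sInf] at hx ⊢
  exact fun M hM => hK M hM T hT x (hx M hM)

/-- If no two invariant closed subspaces with at least one closed subspace strictly in between
are adjacent, then every maximal chain of invariant closed subspaces is a maximal chain. -/
theorem triangularizable_of_exists_between {C : Set (X →L[ℂ] X)}
    (h : ∀ N M L : ClosedSubmodule ℂ X, IsInvariantUnder N C → IsInvariantUnder M C →
      N < L → L < M → ∃ L', N < L' ∧ L' < M ∧ IsInvariantUnder L' C) : Triangularizable C := by
  let r : {M : ClosedSubmodule ℂ X // IsInvariantUnder M C} →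
    {M : ClosedSubmodule ℂ X // IsInvariantUnder M C} → Prop := (· ≤ ·)
  have hmax : IsMaxChain r (maxChain r) := maxChain_spec
  let K : Set (ClosedSubmodule ℂ X) := Subtype.val '' maxChain r
  have hKinv : ∀ M ∈ K, IsInvariantUnder M C := by
    rintro _ ⟨M, -, rfl⟩
    exact M.2
  have hKchain : IsChain (· ≤ ·) K := by
    rintro _ ⟨M, hM, rfl⟩ _ ⟨N, hN, rfl⟩ hne
    exact hmax.1 hM hN fun h0 => hne (congrArg _ h0)
  have hKmem : ∀ M, IsInvariantUnder M C → (∀ N ∈ K, N ≤ M ∨ M ≤ N) → M ∈ K := by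
    intro M hM hcmp
    have hins : IsChain r (insert ⟨M, hM⟩ (maxChain r)) :=
      hmax.1.insert fun N hN _ => (hcmp N ⟨N, hN, rfl⟩).symm
    have := hmax.2 hins (Set.subset_insert _ _)
    exact ⟨⟨M, hM⟩, this ▸ Set.mem_insert _ _, rfl⟩
  refine ⟨K, ⟨hKchain, fun t ht hKt => hKt.antisymm fun L hL => ?_⟩, hKinv⟩
  have hcmpL : ∀ N ∈ K, N ≤ L ∨ L ≤ N := fun N hN => ht.total (hKt hN) hL
  -- `N₀` and `M₀` bound the gap of `K` around `L`. Any invariant subspace between them is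
  -- comparable with all of `K`, hence in `K`; so an invariant subspace strictly between them would
  -- have to lie below `N₀` or above `M₀`.
  let N₀ := sSup {N ∈ K | N ≤ L}
  let M₀ := sInf {N ∈ K | L ≤ N}
  have hN₀L : N₀ ≤ L := sSup_le fun N hN => hN.2
  have hLM₀ : L ≤ M₀ := le_sInf fun N hN => hN.2
  have hleN₀ : ∀ N ∈ K, N ≤ L → N ≤ N₀ := fun N hN hNL => le_sSup ⟨hN, hNL⟩
  have hM₀le : ∀ N ∈ K, L ≤ N → M₀ ≤ N := fun N hN hLN => sInf_le ⟨hN, hLN⟩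
  have hbetween : ∀ P, IsInvariantUnder P C → N₀ ≤ P → P ≤ M₀ → P ∈ K := fun P hP h1 h2 =>
    hKmem P hP fun N hN => (hcmpL N hN).imp (fun h' => (hleN₀ N hN h').trans h1)
      fun h' => h2.trans (hM₀le N hN h')
  have hN₀inv : IsInvariantUnder N₀ C := isInvariantUnder_sSup fun N hN => hKinv N hN.1
  have hM₀inv : IsInvariantUnder M₀ C := isInvariantUnder_sInf fun N hN => hKinv N hN.1
  by_contra hLK
  have hlt : N₀ < L := lt_of_le_of_ne hN₀L fun heq =>
    hLK (heq ▸ hbetween N₀ hN₀inv le_rfl (hN₀L.trans hLM₀))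
  have hlt' : L < M₀ := lt_of_le_of_ne hLM₀ fun heq =>
    hLK (heq ▸ hbetween M₀ hM₀inv (hN₀L.trans hLM₀) le_rfl)
  obtain ⟨P, hNP, hPM, hP⟩ := h N₀ M₀ L hN₀inv hM₀inv hlt hlt'
  have hPK := hbetween P hP hNP.le hPM.le
  rcases hcmpL P hPK with h' | h'
  · exact hNP.not_ge (hleN₀ P hPK h')
  · exact hPM.not_ge (hM₀le P hPK h')

end Chains

end OperatorSemigroup

theorem mainTheorem3
    (R : OperatorSemigroup.OperatorProperty.{u})
    (hquot : OperatorSemigroup.InheritedByQuotients R)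
    (hcomm : OperatorSemigroup.CommSemigroupsHaveInvariantSubspace R)
    (X : Type u) [NormedAddCommGroup X] [NormedSpace ℂ X] [CompleteSpace X]
    (hX : 2 ≤ Module.rank ℂ X)
    (S : Subsemigroup (X →L[ℂ] X))
    (hR : ∀ A ∈ S, R X A)
    (hrank : ∀ A ∈ S, ∀ B ∈ S, ((A * B - B * A : X →L[ℂ] X) : X →ₗ[ℂ] X).rank ≤ 1) :
    OperatorSemigroup.Triangularizable (S : Set (X →L[ℂ] X)) := by
  have hS : OperatorSemigroup.CommutatorsInLines (S : Set (X →L[ℂ] X)) := by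
    intro A hA B hB
    obtain ⟨x, hx⟩ := rank_le_one_iff.1 (hrank A hA B hB)
    refine ⟨x, fun v => ?_⟩
    obtain ⟨c, hc⟩ := hx ⟨A (B v) - B (A v), v, rfl⟩
    exact ⟨c, (congrArg Subtype.val hc).symm⟩
  refine OperatorSemigroup.triangularizable_of_exists_between fun N M L hN hM hNL hLM => ?_
  have hNM : N ≤ M := hNL.le.trans hLM.le
  have hrk := OperatorSemigroup.two_le_rank_subQuotient hNL hLM
  refine OperatorSemigroup.exists_invariant_between hNM hM hN ?_
  refine OperatorSemigroup.hasNontrivialInvariantSubspace hcomm hrk _ ?_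
    (OperatorSemigroup.commutatorsInLines_quotientSemigroup hS hM hN)
  rintro _ ⟨T, hT, rfl⟩
  exact hquot X T (hR T hT) M N hNM (hM T hT) (hN T hT) hrk
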